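/- **Setting.** Let $0\le q\le r\le m$ be integers. For $J\subseteq[m]$ let $\langle J\rangle\le\mathbb Z_2^m$ be the set of bit strings supported in $J$. An $\ell$-cube is a coset $A=x+\langle J\rangle$ with $|J|=\ell$; we write $\dim A=\ell$ and call such sets subcubes. Consider $2^m$ qubits indexed by $\mathbb Z_2^m$. For a single-qubit unitary $U$ and $A\subseteq\mathbb Z_2^m$, let $U_A$ be the operator acting as $U$ on the qubits in $A$ and as the identity on the others. The quantum Reed–Muller code $\mathcal C=QRM_m(q,r)$ is the common $+1$ eigenspace of the group generated by all $X_A$ with $A$ an $(m-q)$-cube and all $Z_A$ with $A$ an $(r+1)$-cube. For an integer $k\ge0$ let $X(k)=|+\rangle\langle+|+e^{i\pi/2^k}|-\rangle\langle-|$. Let $\mathcal S^*$ be the set of unitaries $U\in U(2^{2^m})$ with $U|\psi\rangle=|\psi\rangle$ for all $|\psi\rangle\in\mathcal C$, let $\mathcal N^*$ be the set of unitaries with $U\mathcal C=\mathcal C$, and let $\mathcal E^*=\mathcal N^*\setminus\mathcal S^*$ (the non-trivial logical operators). Let $\mathrm{Cl}^{(0)}$ be the Pauli group on the $2^m$ qubits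 (with phases $\pm1,\pm i$) and, for $k\ge1$, $\mathrm{Cl}^{(k)}=\{U : U\,\mathrm{Cl}^{(0)}U^\dagger\subseteq\mathrm{Cl}^{(k-1)}\}$. Put $\mathcal S^{(k)}=\mathrm{Cl}^{(k)}\cap\mathcal S^*$ (the level-$k$ Clifford stabilizers), $\mathcal S^{(-1)}=\mathcal S^{(0)}$, $\mathcal N^{(k)}=\{U\in\mathrm{Cl}^{(k)} : U\mathcal S^{(0)}U^\dagger\subseteq\mathcal S^{(k-1)}\}$ and $\mathcal E^{(k)}=\mathcal N^{(k)}\setminus\mathcal S^{(k)}$ (the level-$k$ non-trivial Clifford logicals). **Theorem.** Let $k\ge0$ be an integer and let $A\subseteq\mathbb Z_2^m$ be a subcube. 1. Assume $k=0$ or $q\ne m-1$. Then $$X(k)_A\in\mathcal S^* \iff X(k)_A\in\mathcal S^{(k)} \iff \dim A\ge (k+1)(m-q-1)+1 .$$ 2. Assume that $k=0$, or that it is not the case that $q<r=m$. Then $$X(k)_A\in\mathcal E^* \iff X(k)_A\in\mathcal E^{(k)} \iff m-r+k(m-q-1)\le\dim A\le (k+1)(m-q-1).$$ In particular, both parts hold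 for all $k\ge 0$ and $A$ whenever $0\le q<r<m$. -/

import Mathlib

/-! ### Qubit registers, operators, tensor products

A register of qubits indexed by a finite type `ι` has computational basis `ι → Fin 2`; its states are
the vectors `(ι → Fin 2) → ℂ` and its operators the matrices indexed by `ι → Fin 2`. -/

namespace QRM

open Matrix

noncomputable section

/-- The unitary group `U(2)`. -/
abbrev U1 : Type := unitaryGroup (Fin 2) ℂ

/-- The unitary group `U(2^n)` of a register of qubits indexed by `ι`, `n = |ι|`. -/
abbrev UN (ι : Type) [Fintype ι] [DecidableEq ι] : Type := unitaryGroup (ι → Fin 2) ℂ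

/-- The states of a register of qubits indexed by `ι`. -/
abbrev State (ι : Type) : Type := (ι → Fin 2) → ℂ

variable {ι : Type} [Fintype ι]

/-- The tensor product `⨂ x, u x` of single-qubit operators, as a matrix. -/
def tensorMatrix (u : ι → Matrix (Fin 2) (Fin 2) ℂ) : Matrix (ι → Fin 2) (ι → Fin 2) ℂ :=
  Matrix.of fun s t => ∏ x, u x (s x) (t x)

theorem tensorMatrix_mul [DecidableEq ι] (u v : ι → Matrix (Fin 2) (Fin 2) ℂ) :
    tensorMatrix u * tensorMatrix v = tensorMatrix (fun x => u x * v x) := by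
  ext s t
  simp only [tensorMatrix, Matrix.mul_apply, Matrix.of_apply, ← Finset.prod_mul_distrib]
  rw [Finset.prod_univ_sum]
  simp

theorem tensorMatrix_one : tensorMatrix (fun _ : ι => (1 : Matrix (Fin 2) (Fin 2) ℂ)) = 1 := by
  ext s t
  simp only [tensorMatrix, Matrix.of_apply, Matrix.one_apply]
  rw [Finset.prod_ite_zero]
  simp [funext_iff]

theorem tensorMatrix_star (u : ι → Matrix (Fin 2) (Fin 2) ℂ) :
    star (tensorMatrix u) = tensorMatrix (fun x => star (u x)) := by
  ext s t
  simp [tensorMatrix, Matrix.star_apply]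

variable [DecidableEq ι]

/-- The tensor product of single-qubit unitaries, as a unitary of the register. -/
def tensor (u : ι → U1) : UN ι :=
  ⟨tensorMatrix fun x => (u x : Matrix (Fin 2) (Fin 2) ℂ), by
    rw [mem_unitaryGroup_iff, tensorMatrix_star, tensorMatrix_mul, ← tensorMatrix_one]
    congr 1
    funext x
    exact mem_unitaryGroup_iff.mp (u x).2⟩

open Classical in
/-- `U_A`: the operator acting as `u` on the qubits in `A` and as the identity elsewhere. -/
def onSet (u : U1) (A : Set ι) : UN ι := tensor fun x => if x ∈ A then u else 1

/-! ### Single-qubit gates -/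

/-- `|+⟩` -/
def ketPlus : Fin 2 → ℂ := ![1 / (Real.sqrt 2 : ℂ), 1 / (Real.sqrt 2 : ℂ)]

/-- `|-⟩` -/
def ketMinus : Fin 2 → ℂ := ![1 / (Real.sqrt 2 : ℂ), -1 / (Real.sqrt 2 : ℂ)]

/-- `e^{iπ/2^k}` -/
def phase (k : ℕ) : ℂ := Complex.exp (Complex.I * (Real.pi : ℂ) / 2 ^ k)

/-- `X(k) = |+⟩⟨+| + e^{iπ/2^k} |-⟩⟨-|`, as a matrix. -/
def xRotMatrix (k : ℕ) : Matrix (Fin 2) (Fin 2) ℂ :=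
  vecMulVec ketPlus (star ketPlus) + phase k • vecMulVec ketMinus (star ketMinus)

theorem xRotMatrix_eq (k : ℕ) : xRotMatrix k =
    !![(1 + phase k) / 2, (1 - phase k) / 2; (1 - phase k) / 2, (1 + phase k) / 2] := by
  have h : (Real.sqrt 2 : ℂ) * (Real.sqrt 2 : ℂ) = 2 := by
    rw [← Complex.ofReal_mul, Real.mul_self_sqrt (by norm_num)]; norm_num
  have h' : (Real.sqrt 2 : ℂ)⁻¹ * (Real.sqrt 2 : ℂ)⁻¹ = 1 / 2 := by
    rw [← mul_inv, h]; norm_num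
  ext i j
  fin_cases i <;> fin_cases j <;>
    simp only [xRotMatrix, Matrix.add_apply, Matrix.smul_apply, vecMulVec_apply] <;>
    simp [ketPlus, ketMinus, neg_div, h'] <;> ring

theorem phase_mul_star (k : ℕ) : phase k * star (phase k) = 1 := by
  have : phase k = Complex.exp (((Real.pi / 2 ^ k : ℝ) : ℂ) * Complex.I) := by
    unfold phase; congr 1; push_cast; ring
  rw [this, Complex.star_def, Complex.mul_conj, Complex.normSq_eq_norm_sq,
    Complex.norm_exp_ofReal_mul_I]
  simp

/-- The gate `X(k)` as an element of `U(2)`. -/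
def xRot (k : ℕ) : U1 := ⟨xRotMatrix k, by
  rw [mem_unitaryGroup_iff, xRotMatrix_eq]
  have h := phase_mul_star k
  have h2 : (starRingEnd ℂ) 2 = 2 := Complex.conj_ofNat 2
  rw [Complex.star_def] at h
  ext i j
  fin_cases i <;> fin_cases j <;>
    simp [Matrix.mul_apply, Fin.sum_univ_two, Matrix.star_apply, h2] <;>
    first | linear_combination h / 2 | linear_combination -h / 2⟩

/-- Pauli `X`. -/
def pauliX : U1 := ⟨!![0, 1; 1, 0], by
  rw [mem_unitaryGroup_iff]
  ext i j; fin_cases i <;> fin_cases j <;> simp [Matrix.mul_apply, Matrix.star_apply]⟩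

/-- Pauli `Y`. -/
def pauliY : U1 := ⟨!![0, -Complex.I; Complex.I, 0], by
  rw [mem_unitaryGroup_iff]
  ext i j; fin_cases i <;> fin_cases j <;> simp [Matrix.mul_apply, Matrix.star_apply]⟩

/-- Pauli `Z`. -/
def pauliZ : U1 := ⟨!![1, 0; 0, -1], by
  rw [mem_unitaryGroup_iff]
  ext i j; fin_cases i <;> fin_cases j <;> simp [Matrix.mul_apply, Matrix.star_apply]⟩

/-! ### The Pauli group, the Clifford hierarchy, stabilizer codes -/

/-- The single-qubit Pauli group `{±I, ±iI, ±X, ±iX, ±Y, ±iY, ±Z, ±iZ}`. -/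
def pauliOne : Set U1 :=
  {U | ∃ c ∈ ({1, -1, Complex.I, -Complex.I} : Set ℂ), ∃ P ∈ ({1, pauliX, pauliY, pauliZ} : Set U1),
    (U : Matrix (Fin 2) (Fin 2) ℂ) = c • (P : Matrix (Fin 2) (Fin 2) ℂ)}

/-- The Pauli group of the register: tensor products of single-qubit Pauli operators. -/
def pauliGroup (ι : Type) [Fintype ι] [DecidableEq ι] : Set (UN ι) :=
  {U | ∃ p : ι → U1, (∀ x, p x ∈ pauliOne) ∧ U = tensor p}

/-- The `k`-th level of the Clifford hierarchy; level `0` is the Pauli group.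
In the unitary group, `U⁻¹ = U†`. -/
def cliffordLevel (ι : Type) [Fintype ι] [DecidableEq ι] : ℕ → Set (UN ι)
  | 0 => pauliGroup ι
  | k + 1 => {U | ∀ P ∈ pauliGroup ι, U * P * U⁻¹ ∈ cliffordLevel ι k}

/-- The common `+1` eigenspace of a group of unitaries. -/
def stabilizerCode (S : Subgroup (UN ι)) : Submodule ℂ (State ι) where
  carrier := {ψ | ∀ U ∈ S, (U : Matrix (ι → Fin 2) (ι → Fin 2) ℂ) *ᵥ ψ = ψ}
  add_mem' := by
    intro a b ha hb U hU
    rw [mulVec_add, ha U hU, hb U hU]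
  zero_mem' := by
    intro U _
    exact mulVec_zero _
  smul_mem' := by
    intro c a ha U hU
    rw [mulVec_smul, ha U hU]

/-- `𝒮*`: the unitaries that fix every code state (logical identity). -/
def unitaryStabilizers (C : Submodule ℂ (State ι)) : Set (UN ι) :=
  {U | ∀ ψ ∈ C, (U : Matrix (ι → Fin 2) (ι → Fin 2) ℂ) *ᵥ ψ = ψ}

/-- `𝒩*`: the undetectable unitary errors, `U C = C`. -/
def undetectableErrors (C : Submodule ℂ (State ι)) : Set (UN ι) :=
  {U | C.map (U : Matrix (ι → Fin 2) (ι → Fin 2) ℂ).mulVecLin = C}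

/-- `ℰ* = 𝒩* ∖ 𝒮*`: the (non-trivial) logical operators. -/
def logicalOperators (C : Submodule ℂ (State ι)) : Set (UN ι) :=
  undetectableErrors C \ unitaryStabilizers C

/-- Level-`k` Clifford stabilizers: the elements of the `k`-th level of the Clifford hierarchy that
fix every code state. -/
def cliffordStabilizers (C : Submodule ℂ (State ι)) (k : ℕ) : Set (UN ι) :=
  {U | U ∈ cliffordLevel ι k ∧ ∀ ψ ∈ C, (U : Matrix (ι → Fin 2) (ι → Fin 2) ℂ) *ᵥ ψ = ψ}

/-- Level-`k` undetectable Clifford errors: the elements of the `k`-th level that conjugate Pauli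
stabilizers to level-`(k-1)` Clifford stabilizers, where level `-1` is read as level `0`
(natural-number subtraction does exactly that). -/
def cliffordErrors (C : Submodule ℂ (State ι)) (k : ℕ) : Set (UN ι) :=
  {U | U ∈ cliffordLevel ι k ∧
    ∀ S ∈ cliffordStabilizers C 0, U * S * U⁻¹ ∈ cliffordStabilizers C (k - 1)}

/-- Level-`k` non-trivial Clifford logicals. -/
def cliffordLogicals (C : Submodule ℂ (State ι)) (k : ℕ) : Set (UN ι) :=
  cliffordErrors C k \ cliffordStabilizers C k

/-! ### Subcubes and quantum Reed–Muller codes -/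

/-- The hypercube `ℤ₂^m`. -/
abbrev Cube (m : ℕ) : Type := Fin m → ZMod 2

/-- The standard subcube `⟨J⟩`: the subgroup generated by the standard basis vectors `e_j`, `j ∈ J`,
that is, the bit strings supported in `J`. -/
def standardSubcube {m : ℕ} (J : Finset (Fin m)) : AddSubgroup (Cube m) where
  carrier := {y | ∀ i, i ∉ J → y i = 0}
  add_mem' := by
    intro a b ha hb i hi
    simp [ha i hi, hb i hi]
  zero_mem' := by
    intro i _
    rfl
  neg_mem' := by
    intro a ha i hi
    simp [ha i hi]

/-- `A` is an `ℓ`-cube: a coset `x + ⟨J⟩` of a standard subcube with `|J| = ℓ`. -/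
def IsSubcube {m : ℕ} (A : Set (Cube m)) (ℓ : ℕ) : Prop :=
  ∃ (x : Cube m) (J : Finset (Fin m)), J.card = ℓ ∧ A = (fun y => x + y) '' (standardSubcube J)

/-- The `X` generators: `X_A` for the `(m-q)`-cubes `A`. -/
def xGenerators (m q : ℕ) : Set (UN (Cube m)) :=
  {U | ∃ A : Set (Cube m), IsSubcube A (m - q) ∧ U = onSet pauliX A}

/-- The `Z` generators: `Z_A` for the `(r+1)`-cubes `A`. -/
def zGenerators (m r : ℕ) : Set (UN (Cube m)) :=
  {U | ∃ A : Set (Cube m), IsSubcube A (r + 1) ∧ U = onSet pauliZ A}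

/-- The quantum Reed–Muller code `QRM_m(q,r)` (for `q ≤ r ≤ m`). -/
def code (m q r : ℕ) : Submodule ℂ (State (Cube m)) :=
  stabilizerCode (Subgroup.closure (xGenerators m q ∪ zGenerators m r))

end

end QRM

/-! Hadamards on all qubits make `X(k)_A` diagonal: the basis vector of a bit string `t` is
multiplied by `phase k ^ wt A t`, where `phase k` is a primitive `2^(k+1)`-th root of unity. Code
states become functions supported on the Reed–Muller code of order `s = m-q-1` and invariant under
adding indicators of `(r+1)`-cubes. Hence `X(k)_A` fixes the code iff `2^(k+1)` divides `wt A t` for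
all `t` in that Reed–Muller code, and preserves it iff `wt A t` modulo `2^(k+1)` is unchanged by
those translations.

Both conditions are decided by `wt_add_ind`: adding a cube `B` to `t` changes `wt A t` by `wt A (ind
B)` minus twice the weight of `t` on `A ∩ B`. The factor two buys one power of two, while the
dimension drops by at most the codimension of `B`. Induction gives the divisibility `pow_dvd_wt`;
cubes transversal to `A` show that it is sharp (`exists_not_pow_dvd_wt`) and, for translations, give
`le_of_forall_modEq`.

The Clifford versions add nothing: conjugating a Pauli by `X(k+1)_A` gives, up to phase, `X(k)` on a
subset times that Pauli, so `X(k)_A` lies in level `k`; and for a code stabilized by Paulis,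
level-`k` logicals are the unitary logicals of that level (`mem_cliffordLogicals_iff`). -/

namespace QRM

open Matrix

/-! ### Reed–Muller codes and weights on subcubes -/

section Combinatorics

open Classical in
/-- The indicator function of a set of qubits, as a bit string. -/
noncomputable def ind {ι : Type} (B : Set ι) : ι → ZMod 2 := fun x => if x ∈ B then 1 else 0

open Classical in
/-- The weight of the restriction of the bit string `t` to `A`. -/
noncomputable def wt {ι : Type} [Fintype ι] (A : Set ι) (t : ι → ZMod 2) : ℕ :=
  ∑ x, if x ∈ A ∧ t x = 1 then 1 else 0

/-- The coset `x + ⟨J⟩`, as the set of strings that agree with `x` outside of `J`. -/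
def cube {m : ℕ} (x : Cube m) (J : Finset (Fin m)) : Set (Cube m) := {y | ∀ i, i ∉ J → y i = x i}

theorem isSubcube_iff {m : ℕ} {A : Set (Cube m)} {l : ℕ} :
    IsSubcube A l ↔ ∃ x J, J.card = l ∧ A = cube x J := by
  unfold IsSubcube
  refine exists_congr fun x => exists_congr fun J => and_congr_right fun _ => ?_
  suffices h : (fun y => x + y) '' (standardSubcube J : Set (Cube m)) = cube x J by rw [h]
  ext y
  constructor
  · rintro ⟨z, hz, rfl⟩ i hi
    have : z i = 0 := hz i hi
    simp [this]
  · intro hy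
    refine ⟨y - x, fun i hi => ?_, by simp⟩
    simp [hy i hi]

theorem isSubcube_cube {m : ℕ} (x : Cube m) (J : Finset (Fin m)) : IsSubcube (cube x J) J.card :=
  isSubcube_iff.mpr ⟨x, J, rfl, rfl⟩

theorem IsSubcube.le {m l : ℕ} {A : Set (Cube m)} (hA : IsSubcube A l) : l ≤ m := by
  obtain ⟨x, J, rfl, -⟩ := hA
  simpa using J.card_le_univ

theorem zmod_two_cases (a : ZMod 2) : a = 0 ∨ a = 1 := by
  revert a; decide

/-- Inclusion–exclusion, one coordinate at a time. All divisibility arguments below, in both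
directions, rest on this identity. -/
theorem wt_add_ind {ι : Type} [Fintype ι] (A B : Set ι) (t : ι → ZMod 2) :
    wt A (t + ind B) + 2 * wt (A ∩ B) t = wt A t + wt A (ind B) := by
  classical
  simp only [wt, Finset.mul_sum, ← Finset.sum_add_distrib]
  refine Finset.sum_congr rfl fun x _ => ?_
  have h2 : (1 : ZMod 2) + 1 = 0 := by decide
  rcases zmod_two_cases (t x) with h | h <;> by_cases hA : x ∈ A <;> by_cases hB : x ∈ B <;>
    simp [ind, h, hA, hB, h2]

theorem wt_ind {ι : Type} [Fintype ι] (A B : Set ι) : wt A (ind B) = (A ∩ B).ncard := by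
  classical
  rw [Set.ncard_eq_toFinset_card', wt, Finset.sum_boole]
  simp only [Nat.cast_id]
  congr 1
  ext x
  simp [ind]

theorem wt_zero {ι : Type} [Fintype ι] (A : Set ι) : wt A (0 : ι → ZMod 2) = 0 := by
  simp [wt]

theorem wt_empty {ι : Type} [Fintype ι] (t : ι → ZMod 2) : wt ∅ t = 0 := by
  simp [wt]

theorem cast_wt {ι : Type} [Fintype ι] (A : Set ι) (t : ι → ZMod 2) :
    (wt A t : ZMod 2) = ∑ x, ind A x * t x := by
  classical
  unfold wt
  push_cast
  refine Finset.sum_congr rfl fun x _ => ?_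
  rcases zmod_two_cases (t x) with h | h <;> by_cases hA : x ∈ A <;> simp [ind, h, hA]

theorem even_wt_add {ι : Type} [Fintype ι] {A : Set ι} {t u : ι → ZMod 2}
    (ht : Even (wt A t)) (hu : Even (wt A u)) : Even (wt A (t + u)) := by
  rw [even_iff_two_dvd, ← CharP.cast_eq_zero_iff (ZMod 2) 2, cast_wt] at *
  simp [mul_add, Finset.sum_add_distrib, ht, hu]

theorem ncard_cube {m : ℕ} (x : Cube m) (J : Finset (Fin m)) : (cube x J).ncard = 2 ^ J.card := by
  classical
  have h : cube x J = (Fintype.piFinset fun i => if i ∈ J then Finset.univ else {x i} :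
      Finset (Cube m)) := by
    ext y
    simp only [cube, Set.mem_ofPred_eq, Finset.mem_coe, Fintype.mem_piFinset]
    refine forall_congr' fun i => ?_
    by_cases hi : i ∈ J <;> simp [hi]
  rw [h, Set.ncard_coe_finset, Fintype.card_piFinset]
  simp only [apply_ite Finset.card, Finset.card_singleton, Finset.card_univ, ZMod.card]
  rw [Finset.prod_ite]
  simp

theorem cube_inter {m : ℕ} {x y z : Cube m} {J K : Finset (Fin m)} (hx : z ∈ cube x J)
    (hy : z ∈ cube y K) : cube x J ∩ cube y K = cube z (J ∩ K) := by
  ext w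
  simp only [cube, Set.mem_inter_iff, Set.mem_ofPred_eq, Finset.mem_inter] at *
  constructor
  · rintro ⟨h1, h2⟩ i hi
    by_cases hJ : i ∈ J
    · have hK : i ∉ K := fun h => hi ⟨hJ, h⟩
      rw [h2 i hK, hy i hK]
    · rw [h1 i hJ, hx i hJ]
  · intro h
    exact ⟨fun i hi => by rw [h i (fun h => hi h.1), hx i hi],
      fun i hi => by rw [h i (fun h => hi h.2), hy i hi]⟩

/-- Codimensions add at most: the direction sets satisfy `|J ∩ K| = |J| + |K| - |J ∪ K|`, and the
union has at most `m` elements. -/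
theorem IsSubcube.inter {m a b : ℕ} {A B : Set (Cube m)} (hA : IsSubcube A a) (hB : IsSubcube B b) :
    A ∩ B = ∅ ∨ ∃ c, a + b ≤ c + m ∧ IsSubcube (A ∩ B) c := by
  obtain ⟨x, J, rfl, rfl⟩ := isSubcube_iff.mp hA
  obtain ⟨y, K, rfl, rfl⟩ := isSubcube_iff.mp hB
  rcases Set.eq_empty_or_nonempty (cube x J ∩ cube y K) with h | ⟨z, hx, hy⟩
  · exact Or.inl h
  · refine Or.inr ⟨(J ∩ K).card, ?_, ?_⟩
    · rw [← Finset.card_inter_add_card_union]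
      have := (J ∪ K).card_le_univ
      simp at this
      omega
    · rw [cube_inter hx hy]
      exact isSubcube_cube _ _

theorem IsSubcube.ncard {m a : ℕ} {A : Set (Cube m)} (hA : IsSubcube A a) : A.ncard = 2 ^ a := by
  obtain ⟨x, J, rfl, rfl⟩ := isSubcube_iff.mp hA
  exact ncard_cube x J

theorem IsSubcube.pow_dvd_wt_ind {m a b e : ℕ} {A B : Set (Cube m)} (hA : IsSubcube A a)
    (hB : IsSubcube B b) (h : e + m ≤ a + b) : 2 ^ e ∣ wt A (ind B) := by
  rw [wt_ind]
  rcases hA.inter hB with h0 | ⟨c, hc, hAB⟩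
  · simp [h0]
  · rw [hAB.ncard]
    exact pow_dvd_pow _ (by omega)

/-- The bit strings spanned by the indicators of the `n`-cubes: the Reed–Muller code
`RM(m - n, m)`. -/
def cubeSpan (m n : ℕ) : AddSubmonoid (Cube m → ZMod 2) :=
  AddSubmonoid.closure {t | ∃ B, IsSubcube B n ∧ t = ind B}

/-- The bit strings that meet all `l`-cubes in an even number of points. -/
def evenOn (m l : ℕ) : Set (Cube m → ZMod 2) := {t | ∀ B, IsSubcube B l → Even (wt B t)}

theorem ind_mem_cubeSpan {m n : ℕ} {B : Set (Cube m)} (hB : IsSubcube B n) :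
    ind B ∈ cubeSpan m n := AddSubmonoid.subset_closure ⟨B, hB, rfl⟩

theorem zero_mem_evenOn (m l : ℕ) : (0 : Cube m → ZMod 2) ∈ evenOn m l := by
  intro B _
  simp [wt_zero]

theorem add_mem_evenOn {m l : ℕ} {t u : Cube m → ZMod 2} (ht : t ∈ evenOn m l)
    (hu : u ∈ evenOn m l) : t + u ∈ evenOn m l :=
  fun B hB => even_wt_add (ht B hB) (hu B hB)

theorem ind_mem_evenOn {m l n : ℕ} (h : m + 1 ≤ l + n) {B : Set (Cube m)} (hB : IsSubcube B n) :
    ind B ∈ evenOn m l := by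
  intro A hA
  rw [even_iff_two_dvd]
  simpa using hA.pow_dvd_wt_ind (e := 1) hB (by omega)

/-- The easy half of duality: cubes whose dimensions sum to more than `m` meet in the empty set or
in a cube of positive dimension. -/
theorem cubeSpan_subset_evenOn {m l n : ℕ} (h : m + 1 ≤ l + n) {t : Cube m → ZMod 2}
    (ht : t ∈ cubeSpan m n) : t ∈ evenOn m l := by
  induction ht using AddSubmonoid.closure_induction with
  | mem t ht =>
    obtain ⟨B, hB, rfl⟩ := ht
    exact ind_mem_evenOn h hB
  | zero => exact zero_mem_evenOn m l
  | add t u _ _ ht hu => exact add_mem_evenOn ht hu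

/-- A cube is the disjoint union of two opposite facets. Repeated splitting puts large cubes in the
span of smaller ones. -/
theorem ind_cube_insert {m : ℕ} (x : Cube m) {J : Finset (Fin m)} {j : Fin m} (hj : j ∉ J) :
    ind (cube x (insert j J)) = ind (cube x J) + ind (cube (Function.update x j (x j + 1)) J) := by
  classical
  ext y
  have h1 : y ∈ cube x J ↔ y ∈ cube x (insert j J) ∧ y j = x j := by
    constructor
    · intro h
      exact ⟨fun i hi => h i fun hJ => hi (Finset.mem_insert_of_mem hJ), h j hj⟩
    · rintro ⟨h, h'⟩ i hi
      by_cases hij : i = j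
      · rw [hij, h']
      · exact h i (by simp [hij, hi])
  have h2 : y ∈ cube (Function.update x j (x j + 1)) J ↔
      y ∈ cube x (insert j J) ∧ y j = x j + 1 := by
    constructor
    · intro h
      refine ⟨fun i hi => ?_, by simpa using h j hj⟩
      rw [Finset.mem_insert, not_or] at hi
      simpa [hi.1] using h i hi.2
    · rintro ⟨h, h'⟩ i hi
      by_cases hij : i = j
      · simp [hij, h']
      · simpa [hij] using h i (by simp [hij, hi])
  simp only [ind, Pi.add_apply, h1, h2]
  have h3 : y j = x j ∨ y j = x j + 1 := by
    generalize y j = a; generalize x j = b; revert a b; decide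
  have h4 : x j + 1 ≠ x j := by generalize x j = b; revert b; decide
  by_cases h : y ∈ cube x (insert j J)
  · rcases h3 with h3 | h3 <;> simp [h, h3, h4]
  · simp [h]

theorem ind_cube_mem_cubeSpan {m n : ℕ} (x : Cube m) (J : Finset (Fin m)) (h : n ≤ J.card) :
    ind (cube x J) ∈ cubeSpan m n := by
  induction J using Finset.induction_on generalizing x with
  | empty => exact ind_mem_cubeSpan (by simpa [Nat.le_zero.mp h] using isSubcube_cube x ∅)
  | insert j J hj ih =>
    rcases h.eq_or_lt with h | h
    · exact ind_mem_cubeSpan (h ▸ isSubcube_cube _ _)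
    · rw [Finset.card_insert_of_notMem hj] at h
      rw [ind_cube_insert x hj]
      exact add_mem (ih _ (by omega)) (ih _ (by omega))

theorem IsSubcube.ind_mem_cubeSpan {m n l : ℕ} {B : Set (Cube m)} (hB : IsSubcube B l)
    (h : n ≤ l) : ind B ∈ cubeSpan m n := by
  obtain ⟨x, J, rfl, rfl⟩ := isSubcube_iff.mp hB
  exact ind_cube_mem_cubeSpan x J h

/-- Evenness on a cube is orthogonality to its indicator, and a larger cube is a sum of `l`-cubes.
-/
theorem evenOn_mono {m l l' : ℕ} (h : l ≤ l') {t : Cube m → ZMod 2} (ht : t ∈ evenOn m l) :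
    t ∈ evenOn m l' := by
  intro B hB
  have key : ∀ u ∈ cubeSpan m l, ∑ x, u x * t x = 0 := by
    intro u hu
    induction hu using AddSubmonoid.closure_induction with
    | mem u hu =>
      obtain ⟨B, hB, rfl⟩ := hu
      rw [← cast_wt, CharP.cast_eq_zero_iff (ZMod 2) 2, ← even_iff_two_dvd]
      exact ht B hB
    | zero => simp
    | add u v _ _ hu hv => simp [add_mul, Finset.sum_add_distrib, hu, hv]
  rw [even_iff_two_dvd, ← CharP.cast_eq_zero_iff (ZMod 2) 2, cast_wt]
  exact key _ (hB.ind_mem_cubeSpan h)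

/-- Möbius inversion: the algebraic normal form of a Boolean function. -/
theorem eq_sum_monomials {m : ℕ} (t : Cube m → ZMod 2) :
    t = ∑ J : Finset (Fin m), (wt (cube 0 J) t : ZMod 2) • ind (cube 1 Jᶜ) := by
  classical
  ext z
  set supp : Cube m → Finset (Fin m) := fun y => Finset.univ.filter fun i => y i = 1 with hs
  have h0 : ∀ (J : Finset (Fin m)) (y : Cube m), y ∈ cube 0 J ↔ supp y ⊆ J := by
    intro J y
    simp only [cube, Set.mem_ofPred_eq, Pi.zero_apply, hs, Finset.subset_iff, Finset.mem_filter,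
      Finset.mem_univ, true_and]
    refine forall_congr' fun i => ?_
    rcases zmod_two_cases (y i) with h | h <;> simp [h]
  have h1 : ∀ (J : Finset (Fin m)) (y : Cube m), y ∈ cube 1 Jᶜ ↔ J ⊆ supp y := by
    intro J y
    simp only [cube, Set.mem_ofPred_eq, Pi.one_apply, hs, Finset.subset_iff, Finset.mem_filter,
      Finset.mem_univ, true_and, Finset.mem_compl, not_not]
  have hinj : ∀ y, supp y = supp z → y = z := by
    intro y h
    ext i
    have := Finset.ext_iff.mp h i
    simp only [hs, Finset.mem_filter, Finset.mem_univ, true_and] at this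
    rcases zmod_two_cases (y i) with h | h <;> rcases zmod_two_cases (z i) with h' | h' <;>
      simp_all
  simp only [Finset.sum_apply, Pi.smul_apply, smul_eq_mul, cast_wt, ind, h0, h1, Finset.sum_mul]
  rw [Finset.sum_comm]
  -- The number of `J` between `supp y` and `supp z` is zero or a power of two, and it is odd only
  -- for `y = z`.
  have hy : ∀ y : Cube m, (∑ J : Finset (Fin m), (if supp y ⊆ J then (1 : ZMod 2) else 0) * t y *
      (if J ⊆ supp z then 1 else 0)) = if y = z then t y else 0 := by
    intro y
    have : ∀ J : Finset (Fin m), (if supp y ⊆ J then (1 : ZMod 2) else 0) * t y *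
        (if J ⊆ supp z then 1 else 0) = (if J ∈ Finset.Icc (supp y) (supp z) then 1 else 0) * t y := by
      intro J
      by_cases ha : supp y ⊆ J <;> by_cases hb : J ⊆ supp z <;> simp [ha, hb]
    rw [Finset.sum_congr rfl fun J _ => this J, ← Finset.sum_mul, Finset.sum_boole]
    simp only [Finset.filter_univ_mem]
    by_cases hyz : y = z
    · simp [hyz]
    · simp only [hyz, if_false]
      by_cases hsub : supp y ⊆ supp z
      · rw [Finset.card_Icc_finset hsub]
        have hlt : (supp y).card < (supp z).card :=
          Finset.card_lt_card (hsub.ssubset_of_ne fun h => hyz (hinj y h))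
        obtain ⟨e, he⟩ : ∃ e, (supp z).card - (supp y).card = e + 1 :=
          ⟨(supp z).card - (supp y).card - 1, by omega⟩
        have h2 : (2 : ZMod 2) = 0 := by decide
        simp [he, pow_succ, h2]
      · rw [Finset.Icc_eq_empty hsub]
        simp
  rw [Finset.sum_congr rfl fun y _ => hy y]
  simp

/-- Duality of Reed–Muller codes. -/
theorem evenOn_subset_cubeSpan {m l n : ℕ} (h : l + n ≤ m + 1) {t : Cube m → ZMod 2}
    (ht : t ∈ evenOn m l) : t ∈ cubeSpan m n := by
  rw [eq_sum_monomials t]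
  refine sum_mem fun J _ => ?_
  -- Evenness kills the coefficients of degree at least `l`; a monomial of lower degree is the
  -- indicator of a cube of dimension at least `n`.
  by_cases hJ : l ≤ J.card
  · have : Even (wt (cube 0 J) t) := evenOn_mono hJ ht _ (isSubcube_cube 0 J)
    rw [even_iff_two_dvd, ← CharP.cast_eq_zero_iff (ZMod 2) 2] at this
    rw [this, zero_smul]
    exact zero_mem _
  · have hmem : ind (cube 1 Jᶜ) ∈ cubeSpan m n :=
      ind_cube_mem_cubeSpan 1 Jᶜ (by
        rw [Finset.card_compl, Fintype.card_fin]; omega)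
    rcases zmod_two_cases (wt (cube 0 J) t : ZMod 2) with h | h <;> rw [h]
    · simp
    · simpa using hmem

/-- Divisibility of the weights in a Reed–Muller code (McEliece). -/
theorem pow_dvd_wt {m n s : ℕ} (hns : m ≤ n + s) {t : Cube m → ZMod 2} (ht : t ∈ cubeSpan m n)
    {k a : ℕ} (hk : 1 ≤ s ∨ k ≤ 1) {A : Set (Cube m)} (hA : IsSubcube A a) (ha : k * s + 1 ≤ a) :
    2 ^ k ∣ wt A t := by
  -- The exponent and `A` must vary, because the cross term asks for one power of two less on the
  -- smaller cube `A ∩ B`.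
  induction ht using AddSubmonoid.closure_induction_right generalizing k a A with
  | zero => simp [wt_zero]
  | add_right t _ u hu ih =>
    obtain ⟨B, hB, rfl⟩ := hu
    rcases k with _ | k
    · simp
    -- This makes `A ∩ B` large enough for `2^(k+1)` to divide `wt A (ind B)`. It fails for `s = 0`,
    -- `k > 0`, which is why `q = m-1` is excluded for positive levels.
    have hks : k ≤ k * s := by
      rcases hk with hk | hk
      · exact Nat.le_mul_of_pos_right k hk
      · have : k = 0 := by omega
        simp [this]
    rw [add_mul, one_mul] at ha
    have h1 : 2 ^ (k + 1) ∣ wt A t := ih hk hA (by rw [add_mul, one_mul]; exact ha)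
    have h2 : 2 ^ (k + 1) ∣ wt A (ind B) := hA.pow_dvd_wt_ind hB (by omega)
    have h3 : 2 ^ (k + 1) ∣ 2 * wt (A ∩ B) t := by
      rw [pow_succ']
      refine mul_dvd_mul_left 2 ?_
      rcases hA.inter hB with h0 | ⟨c, hc, hAB⟩
      · simp [h0, wt_empty]
      · exact ih (hk.imp_right fun h => by omega) hAB (by omega)
    rw [← Nat.dvd_add_left h3, wt_add_ind]
    exact dvd_add h1 h2

theorem pow_dvd_wt_add_ind_modEq {m n s : ℕ} (hns : m ≤ n + s) {t : Cube m → ZMod 2}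
    (ht : t ∈ cubeSpan m n) {k a b : ℕ} (hk : 1 ≤ s ∨ k = 0) {A B : Set (Cube m)}
    (hA : IsSubcube A a) (hB : IsSubcube B b) (hab : k * s + 1 + m ≤ a + b) :
    wt A (t + ind B) ≡ wt A t [MOD 2 ^ (k + 1)] := by
  have hks : k ≤ k * s := by
    rcases hk with hk | hk
    · exact Nat.le_mul_of_pos_right k hk
    · simp [hk]
  have h2 : 2 ^ (k + 1) ∣ wt A (ind B) := hA.pow_dvd_wt_ind hB (by omega)
  have h3 : 2 ^ (k + 1) ∣ 2 * wt (A ∩ B) t := by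
    rw [pow_succ']
    refine mul_dvd_mul_left 2 ?_
    rcases hA.inter hB with h0 | ⟨c, hc, hAB⟩
    · simp [h0, wt_empty]
    · exact pow_dvd_wt hns ht (hk.imp_right fun h => by omega) hAB (by omega)
  have h := wt_add_ind A B t
  have h4 : wt A (t + ind B) ≡ wt A (t + ind B) + 2 * wt (A ∩ B) t [MOD 2 ^ (k + 1)] := by
    simpa using (Nat.ModEq.refl (wt A (t + ind B))).add ((Nat.modEq_zero_iff_dvd.mpr h3).symm)
  have h5 : wt A t + wt A (ind B) ≡ wt A t [MOD 2 ^ (k + 1)] := by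
    simpa using (Nat.ModEq.refl (wt A t)).add (Nat.modEq_zero_iff_dvd.mpr h2)
  exact h4.trans (h ▸ h5)

/-- `B` freezes `e` of the free directions of `A` and leaves every other coordinate free. -/
theorem IsSubcube.exists_inter {m a e : ℕ} {A : Set (Cube m)} (hA : IsSubcube A a) (he : e ≤ a) :
    ∃ B, IsSubcube B (m - e) ∧ IsSubcube (A ∩ B) (a - e) := by
  obtain ⟨x, J, rfl, rfl⟩ := isSubcube_iff.mp hA
  obtain ⟨K, hK, rfl⟩ := Finset.exists_subset_card_eq he
  refine ⟨cube x Kᶜ, ?_, ?_⟩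
  · have := isSubcube_cube x Kᶜ
    rwa [Finset.card_compl, Fintype.card_fin] at this
  · rw [cube_inter (z := x) (fun _ _ => rfl) (fun _ _ => rfl), ← Finset.sdiff_eq_inter_compl,
      ← Finset.card_sdiff_of_subset hK]
    exact isSubcube_cube _ _

theorem IsSubcube.wt_ind_inter_point {m a : ℕ} {A B : Set (Cube m)} (h : IsSubcube (A ∩ B) a)
    (ha : a = 0) : wt A (ind B) = 1 := by
  rw [wt_ind, h.ncard, ha, pow_zero]

/-- The weight identity read backwards: control of `A` modulo `2^(k+1)` gives control of `A ∩ B`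
modulo `2^k`. -/
theorem pow_dvd_wt_inter {ι : Type} [Fintype ι] {A B : Set ι} {t : ι → ZMod 2} {k : ℕ}
    (h0 : 2 ^ (k + 1) ∣ wt A (ind B))
    (h : wt A (t + ind B) ≡ wt A t [MOD 2 ^ (k + 1)]) : 2 ^ k ∣ wt (A ∩ B) t := by
  have h1 := wt_add_ind A B t
  have h2 : wt A (t + ind B) + 2 * wt (A ∩ B) t ≡ wt A t + 0 [MOD 2 ^ (k + 1)] := by
    rw [h1]
    exact (Nat.ModEq.refl _).add (Nat.modEq_zero_iff_dvd.mpr h0)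
  have h3 := Nat.modEq_zero_iff_dvd.mp (Nat.ModEq.add_left_cancel h h2)
  rw [pow_succ'] at h3
  exact Nat.dvd_of_mul_dvd_mul_left two_pos h3

/-- The divisibility of the weights in a Reed–Muller code is sharp. -/
theorem exists_not_pow_dvd_wt {m s : ℕ} (hs : s + 1 ≤ m) {k a : ℕ} {A : Set (Cube m)}
    (hA : IsSubcube A a) (ha : a ≤ (k + 1) * s) :
    ∃ t ∈ evenOn m (s + 1), ¬ 2 ^ (k + 1) ∣ wt A t := by
  induction k generalizing a A with
  | zero =>
    obtain ⟨B, hB, hAB⟩ := hA.exists_inter le_rfl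
    refine ⟨ind B, ind_mem_evenOn (by omega) hB, ?_⟩
    rw [hAB.wt_ind_inter_point (by omega)]
    norm_num
  | succ k ih =>
    by_contra! hall
    -- Freezing at most `s` directions keeps `ind B` in the Reed–Muller code; the minimum covers `a
    -- < s`, where `A ∩ B` is a point.
    obtain ⟨B, hB, hAB⟩ := hA.exists_inter (min_le_right s a)
    have hBm : ind B ∈ evenOn m (s + 1) := ind_mem_evenOn (by omega) hB
    obtain ⟨t, ht, hnot⟩ := ih hAB (by rw [add_mul, one_mul] at ha; omega)
    refine hnot (pow_dvd_wt_inter (hall _ hBm) ?_)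
    exact (Nat.modEq_zero_iff_dvd.mpr (hall _ (add_mem_evenOn ht hBm))).trans
      (Nat.modEq_zero_iff_dvd.mpr (hall _ ht)).symm

/-- All strings in `RM(s, m)` have weights on an `a`-cube that are divisible by `2 ^ (k + 1)`
exactly when `(k + 1) * s < a`. -/
theorem forall_pow_dvd_wt_iff {m s k a : ℕ} (hs : s + 1 ≤ m) (hk : 1 ≤ s ∨ k = 0)
    {A : Set (Cube m)} (hA : IsSubcube A a) :
    (∀ t ∈ evenOn m (s + 1), 2 ^ (k + 1) ∣ wt A t) ↔ (k + 1) * s + 1 ≤ a := by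
  constructor
  · intro h
    by_contra! hlt
    obtain ⟨t, ht, hnot⟩ := exists_not_pow_dvd_wt hs hA (Nat.lt_succ_iff.mp hlt)
    exact hnot (h t ht)
  · intro h t ht
    exact pow_dvd_wt (n := m - s) (by omega) (evenOn_subset_cubeSpan (by omega) ht)
      (hk.imp_right fun h => by omega) hA h

/-- Starting from `t = 0`, invariance forces divisibility on the span of the `(m-p)`-cubes. If `a ≤
p`, a cube in that span meets `A` in one point, of odd weight. Otherwise an `(m-p)`-cube cuts `A`
down by `p` dimensions, and the sharp bound for `A ∩ B`, one power lower, is contradicted. -/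
theorem le_of_forall_modEq {m s p k a : ℕ} (hs : s + 1 ≤ m) (hp : p ≤ s)
    {A : Set (Cube m)} (hA : IsSubcube A a)
    (h : ∀ t ∈ evenOn m (s + 1), ∀ B, IsSubcube B (m - p) →
      wt A (t + ind B) ≡ wt A t [MOD 2 ^ (k + 1)]) : k * s + p + 1 ≤ a := by
  have h0 : ∀ t ∈ cubeSpan m (m - p), 2 ^ (k + 1) ∣ wt A t := by
    intro t ht
    induction ht using AddSubmonoid.closure_induction_right with
    | zero => simp [wt_zero]
    | add_right t ht u hu ih =>
      obtain ⟨B, hB, rfl⟩ := hu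
      have := h t (cubeSpan_subset_evenOn (by omega) ht) B hB
      exact Nat.modEq_zero_iff_dvd.mp (this.trans (Nat.modEq_zero_iff_dvd.mpr ih))
  by_contra! hlt
  by_cases hap : a ≤ p
  · obtain ⟨B, hB, hAB⟩ := hA.exists_inter le_rfl
    have := h0 (ind B) (hB.ind_mem_cubeSpan (by omega))
    rw [hAB.wt_ind_inter_point (by omega), Nat.dvd_one] at this
    simp at this
  · obtain ⟨B, hB, hAB⟩ := hA.exists_inter (e := p) (by omega)
    rcases k with _ | k
    · omega
    · obtain ⟨t, ht, hnot⟩ := exists_not_pow_dvd_wt (k := k) hs hAB (by omega)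
      exact hnot (pow_dvd_wt_inter (h0 _ (ind_mem_cubeSpan hB)) (h t ht B hB))

end Combinatorics

end QRM

namespace QRM

open Matrix

noncomputable section

/-! ### Pauli operators and the Clifford hierarchy -/

section PauliClifford

theorem ext_U1 {U V : U1} (h : ∀ i j, (U : Matrix (Fin 2) (Fin 2) ℂ) i j = V.1 i j) : U = V :=
  Subtype.ext (Matrix.ext h)

/-- Multiplication by a phase, as a single-qubit unitary. -/
def scal (c : ℂ) (hc : c * star c = 1) : U1 := ⟨c • 1, by
  rw [mem_unitaryGroup_iff, star_smul, star_one, smul_mul_smul_comm, hc, one_mul, one_smul]⟩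

theorem scal_mul (c : ℂ) (hc : c * star c = 1) (U : U1) :
    ((scal c hc * U : U1) : Matrix (Fin 2) (Fin 2) ℂ) = c • (U : Matrix (Fin 2) (Fin 2) ℂ) := by
  simp [scal]

theorem phases_mul {c d : ℂ} (hc : c ∈ ({1, -1, Complex.I, -Complex.I} : Set ℂ))
    (hd : d ∈ ({1, -1, Complex.I, -Complex.I} : Set ℂ)) :
    c * d ∈ ({1, -1, Complex.I, -Complex.I} : Set ℂ) := by
  simp only [Set.mem_insert_iff, Set.mem_singleton_iff] at *
  rcases hc with rfl | rfl | rfl | rfl <;> rcases hd with rfl | rfl | rfl | rfl <;> simp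

theorem smul_mem_pauliOne {c : ℂ} (hc : c ∈ ({1, -1, Complex.I, -Complex.I} : Set ℂ)) {U V : U1}
    (hV : V ∈ pauliOne) (h : (U : Matrix (Fin 2) (Fin 2) ℂ) = c • (V : Matrix (Fin 2) (Fin 2) ℂ)) :
    U ∈ pauliOne := by
  obtain ⟨d, hd, P, hP, h'⟩ := hV
  exact ⟨c * d, phases_mul hc hd, P, hP, by rw [h, h', smul_smul]⟩

theorem pauli_mem {P : U1} (hP : P ∈ ({1, pauliX, pauliY, pauliZ} : Set U1)) : P ∈ pauliOne :=
  ⟨1, by simp, P, hP, by simp⟩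

theorem pauli_mul_mem {P Q : U1} (hP : P ∈ ({1, pauliX, pauliY, pauliZ} : Set U1))
    (hQ : Q ∈ ({1, pauliX, pauliY, pauliZ} : Set U1)) : P * Q ∈ pauliOne := by
  have key : ∀ (U V : U1) (c : ℂ), c ∈ ({1, -1, Complex.I, -Complex.I} : Set ℂ) →
      V ∈ ({1, pauliX, pauliY, pauliZ} : Set U1) → (U : Matrix (Fin 2) (Fin 2) ℂ) = c • V.1 →
      U ∈ pauliOne := fun U V c hc hV h => ⟨c, hc, V, hV, h⟩
  have h1 : (1 : U1) ∈ ({1, pauliX, pauliY, pauliZ} : Set U1) := by simp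
  have hX : pauliX ∈ ({1, pauliX, pauliY, pauliZ} : Set U1) := by simp
  have hY : pauliY ∈ ({1, pauliX, pauliY, pauliZ} : Set U1) := by simp
  have hZ : pauliZ ∈ ({1, pauliX, pauliY, pauliZ} : Set U1) := by simp
  have c1 : (1 : ℂ) ∈ ({1, -1, Complex.I, -Complex.I} : Set ℂ) := by simp
  have cI : Complex.I ∈ ({1, -1, Complex.I, -Complex.I} : Set ℂ) := by simp
  have cJ : -Complex.I ∈ ({1, -1, Complex.I, -Complex.I} : Set ℂ) := by simp
  rcases hP with rfl | rfl | rfl | rfl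
  · rw [one_mul]; exact pauli_mem hQ
  · rcases hQ with rfl | rfl | rfl | rfl
    · rw [mul_one]; exact pauli_mem hX
    · refine key _ 1 1 c1 h1 ?_
      ext i j; fin_cases i <;> fin_cases j <;> simp [pauliX]
    · refine key _ pauliZ _ cI hZ ?_
      ext i j; fin_cases i <;> fin_cases j <;> simp [pauliX, pauliY, pauliZ]
    · refine key _ pauliY _ cJ hY ?_
      ext i j; fin_cases i <;> fin_cases j <;> simp [pauliX, pauliY, pauliZ]
  · rcases hQ with rfl | rfl | rfl | rfl
    · rw [mul_one]; exact pauli_mem hY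
    · refine key _ pauliZ _ cJ hZ ?_
      ext i j; fin_cases i <;> fin_cases j <;> simp [pauliX, pauliY, pauliZ]
    · refine key _ 1 1 c1 h1 ?_
      ext i j; fin_cases i <;> fin_cases j <;> simp [pauliY]
    · refine key _ pauliX _ cI hX ?_
      ext i j; fin_cases i <;> fin_cases j <;> simp [pauliX, pauliY, pauliZ]
  · rcases hQ with rfl | rfl | rfl | rfl
    · rw [mul_one]; exact pauli_mem hZ
    · refine key _ pauliY _ cI hY ?_
      ext i j; fin_cases i <;> fin_cases j <;> simp [pauliX, pauliY, pauliZ]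
    · refine key _ pauliX _ cJ hX ?_
      ext i j; fin_cases i <;> fin_cases j <;> simp [pauliX, pauliY, pauliZ]
    · refine key _ 1 1 c1 h1 ?_
      ext i j; fin_cases i <;> fin_cases j <;> simp [pauliZ]

theorem pauliOne_mul {U V : U1} (hU : U ∈ pauliOne) (hV : V ∈ pauliOne) : U * V ∈ pauliOne := by
  obtain ⟨c, hc, P, hP, h⟩ := hU
  obtain ⟨d, hd, Q, hQ, h'⟩ := hV
  refine smul_mem_pauliOne (phases_mul hc hd) (pauli_mul_mem hP hQ) ?_
  simp only [Matrix.UnitaryGroup.mul_val, h, h', smul_mul_smul_comm]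

theorem pauliOne_inv {U : U1} (hU : U ∈ pauliOne) : U⁻¹ ∈ pauliOne := by
  obtain ⟨c, hc, P, hP, h⟩ := hU
  refine ⟨star c, ?_, P, hP, ?_⟩
  · simp only [Set.mem_insert_iff, Set.mem_singleton_iff] at *
    rcases hc with rfl | rfl | rfl | rfl <;> simp
  · rw [Matrix.UnitaryGroup.inv_val, h, star_smul]
    congr 1
    rcases hP with rfl | rfl | rfl | rfl
    · simp
    all_goals
      ext i j
      fin_cases i <;> fin_cases j <;> simp [pauliX, pauliY, pauliZ, Matrix.star_apply]

theorem phase_succ_sq (k : ℕ) : phase (k + 1) * phase (k + 1) = phase k := by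
  unfold phase
  rw [← Complex.exp_add]
  congr 1
  rw [pow_succ]
  field_simp
  ring

theorem phase_zero : phase 0 = -1 := by
  rw [phase, pow_zero, div_one, mul_comm, Complex.exp_pi_mul_I]

theorem xRot_zero : xRot 0 = pauliX := by
  refine ext_U1 fun i j => ?_
  fin_cases i <;> fin_cases j <;> simp [xRot, xRotMatrix_eq, phase_zero, pauliX]

theorem phase_one : phase 1 = Complex.I := by
  have : phase 1 = Complex.exp ((Real.pi : ℂ) / 2 * Complex.I) := by
    unfold phase; congr 1; ring
  rw [this, Complex.exp_pi_div_two_mul_I]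

theorem star_phase_mul_star (k : ℕ) : star (phase k) * star (star (phase k)) = 1 := by
  rw [star_star, mul_comm, phase_mul_star]

theorem pauliX_comm_xRot (k : ℕ) : xRot k * pauliX = pauliX * xRot k := by
  refine ext_U1 fun i j => ?_
  fin_cases i <;> fin_cases j <;> simp [xRot, xRotMatrix_eq, pauliX]

/-- `Z` swaps `|+⟩` and `|-⟩`. With `w = phase (k+1)`, the commutator of `X(k+1)` and `Z` has
eigenvalues `w̄` and `w = w̄ w²`, and `w² = phase k`. -/
theorem xRot_mul_pauliZ (k : ℕ) : xRot (k + 1) * pauliZ =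
    scal _ (star_phase_mul_star (k + 1)) * (xRot k * pauliZ) * xRot (k + 1) := by
  refine ext_U1 fun i j => ?_
  have h := phase_mul_star (k + 1)
  have h2 := phase_succ_sq k
  rw [Complex.star_def] at h
  fin_cases i <;> fin_cases j <;>
    simp [xRot, xRotMatrix_eq, pauliZ, scal] <;>
    generalize phase (k + 1) = w at * <;> generalize (starRingEnd ℂ) w = v at * <;>
    generalize phase k = u at * <;> subst h2 <;>
    first
      | linear_combination ((1 + w) / -2) * h
      | linear_combination ((1 + w) / 2) * h
      | linear_combination ((1 - w) / 2) * h
      | linear_combination ((1 - w) / -2) * h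

theorem scal_comm (c : ℂ) (hc : c * star c = 1) (U : U1) : scal c hc * U = U * scal c hc := by
  apply Subtype.ext
  simp [scal]

theorem scal_one : scal 1 (by simp) = 1 := by
  apply Subtype.ext
  simp [scal]

theorem pauliY_eq : pauliY = scal Complex.I (by simp) * (pauliX * pauliZ) := by
  refine ext_U1 fun i j => ?_
  fin_cases i <;> fin_cases j <;> simp [pauliX, pauliY, pauliZ, scal]

theorem phases_mul_star {c : ℂ} (hc : c ∈ ({1, -1, Complex.I, -Complex.I} : Set ℂ)) :
    c * star c = 1 := by
  simp only [Set.mem_insert_iff, Set.mem_singleton_iff] at hc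
  rcases hc with rfl | rfl | rfl | rfl <;> simp

/-- Conjugating a single-qubit Pauli operator by `X(k+1)` multiplies it by a phase and, possibly,
by `X(k)`. -/
theorem xRot_conj_pauliOne (k : ℕ) {p : U1} (hp : p ∈ pauliOne) :
    ∃ (c : ℂ) (hc : c * star c = 1), (c = 1 ∨ c = star (phase (k + 1))) ∧
      ∃ g : U1, (g = 1 ∨ g = xRot k) ∧
        xRot (k + 1) * p * (xRot (k + 1))⁻¹ = scal c hc * (g * p) := by
  simp only [mul_inv_eq_iff_eq_mul]
  obtain ⟨d, hd, P, hP, h⟩ := hp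
  have hp' : p = scal d (phases_mul_star hd) * P := Subtype.ext (by rw [scal_mul, h])
  suffices hs : ∃ (c : ℂ) (hc : c * star c = 1), (c = 1 ∨ c = star (phase (k + 1))) ∧
      ∃ g : U1, (g = 1 ∨ g = xRot k) ∧
        xRot (k + 1) * P = scal c hc * (g * P) * xRot (k + 1) by
    obtain ⟨c, hc, hc', g, hg, h⟩ := hs
    refine ⟨c, hc, hc', g, hg, ?_⟩
    rw [hp', scal_comm, ← mul_assoc, h]
    simp only [mul_assoc, scal_comm d]
  have hcomm : ∀ Q : U1, xRot (k + 1) * Q = Q * xRot (k + 1) →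
      ∃ (c : ℂ) (hc : c * star c = 1), (c = 1 ∨ c = star (phase (k + 1))) ∧
      ∃ g : U1, (g = 1 ∨ g = xRot k) ∧
        xRot (k + 1) * Q = scal c hc * (g * Q) * xRot (k + 1) := fun Q hQ =>
    ⟨1, by simp, Or.inl rfl, 1, Or.inl rfl, by rw [scal_one, one_mul, one_mul, hQ]⟩
  rcases hP with rfl | rfl | rfl | rfl
  · exact hcomm _ (by simp)
  · exact hcomm _ (pauliX_comm_xRot _)
  · refine ⟨_, star_phase_mul_star (k + 1), Or.inr rfl, xRot k, Or.inr rfl, ?_⟩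
    rw [pauliY_eq, scal_comm Complex.I, ← mul_assoc, ← mul_assoc, pauliX_comm_xRot,
      mul_assoc pauliX, xRot_mul_pauliZ]
    simp only [← mul_assoc, ← scal_comm Complex.I]
    simp only [mul_assoc, ← scal_comm (star (phase (k + 1)))]
    simp only [← mul_assoc, pauliX_comm_xRot]
  · exact ⟨_, star_phase_mul_star (k + 1), Or.inr rfl, xRot k, Or.inr rfl, xRot_mul_pauliZ k⟩

variable {ι : Type} [Fintype ι] [DecidableEq ι]

theorem tensor_mul (u v : ι → U1) : tensor u * tensor v = tensor (fun x => u x * v x) :=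
  Subtype.ext (tensorMatrix_mul _ _)

theorem tensor_one : tensor (fun _ : ι => (1 : U1)) = 1 :=
  Subtype.ext tensorMatrix_one

theorem tensor_inv (u : ι → U1) : (tensor u)⁻¹ = tensor (fun x => (u x)⁻¹) := by
  rw [inv_eq_iff_mul_eq_one, tensor_mul, ← tensor_one]
  simp

theorem tensor_scal_comm (c : ι → ℂ) (hc : ∀ x, c x * star (c x) = 1) (U : UN ι) :
    tensor (fun x => scal (c x) (hc x)) * U = U * tensor (fun x => scal (c x) (hc x)) := by
  have h : (tensor (fun x => scal (c x) (hc x)) : UN ι).1 =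
      (∏ x, c x) • (1 : Matrix (ι → Fin 2) (ι → Fin 2) ℂ) := by
    rw [← tensorMatrix_one]
    ext s t
    simp [tensor, tensorMatrix, scal, Finset.prod_mul_distrib]
  apply Subtype.ext
  simp only [Matrix.UnitaryGroup.mul_val]
  rw [h]
  simp

theorem pauliGroup_mul {U V : UN ι} (hU : U ∈ pauliGroup ι) (hV : V ∈ pauliGroup ι) :
    U * V ∈ pauliGroup ι := by
  obtain ⟨p, hp, rfl⟩ := hU
  obtain ⟨q, hq, rfl⟩ := hV
  exact ⟨_, fun x => pauliOne_mul (hp x) (hq x), tensor_mul p q⟩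

theorem pauliGroup_inv {U : UN ι} (hU : U ∈ pauliGroup ι) : U⁻¹ ∈ pauliGroup ι := by
  obtain ⟨p, hp, rfl⟩ := hU
  exact ⟨_, fun x => pauliOne_inv (hp x), tensor_inv p⟩

theorem onSet_mem_pauliGroup {u : U1} (hu : u ∈ pauliOne) (A : Set ι) :
    onSet u A ∈ pauliGroup ι := by
  classical
  refine ⟨_, fun x => ?_, rfl⟩
  split_ifs
  · exact hu
  · exact pauli_mem (by simp)

theorem cliffordLevel_mul_pauli {k : ℕ} {U P : UN ι} (hU : U ∈ cliffordLevel ι k)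
    (hP : P ∈ pauliGroup ι) : U * P ∈ cliffordLevel ι k := by
  cases k with
  | zero => exact pauliGroup_mul hU hP
  | succ k =>
    intro Q hQ
    have := hU (P * Q * P⁻¹) (pauliGroup_mul (pauliGroup_mul hP hQ) (pauliGroup_inv hP))
    simpa [mul_assoc] using this

/-- Central factors cancel under conjugation. Level `0` is left out, since Paulis carry only four
phases. -/
theorem cliffordLevel_scal_mul {k : ℕ} {z U : UN ι} (hz : ∀ V : UN ι, z * V = V * z)
    (hU : U ∈ cliffordLevel ι (k + 1)) : z * U ∈ cliffordLevel ι (k + 1) := by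
  intro Q hQ
  have : z * U * Q * (z * U)⁻¹ = U * Q * U⁻¹ := by
    rw [hz U, _root_.mul_inv_rev, mul_assoc U z Q, hz Q]
    simp [mul_assoc]
  rw [this]
  exact hU Q hQ

/-- `X(k)_A` belongs to the `k`-th level of the Clifford hierarchy. -/
theorem onSet_xRot_mem_cliffordLevel (k : ℕ) (A : Set ι) :
    onSet (xRot k) A ∈ cliffordLevel ι k := by
  classical
  induction k generalizing A with
  | zero =>
    rw [xRot_zero]
    exact onSet_mem_pauliGroup (pauli_mem (by simp)) A
  | succ k ih =>
    rintro P ⟨p, hp, rfl⟩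
    have hsite : ∀ x, ∃ (c : ℂ) (hc : c * star c = 1), (c = 1 ∨ c = star (phase (k + 1))) ∧
        ∃ g : U1, (g = 1 ∨ g = xRot k) ∧
          (if x ∈ A then xRot (k + 1) else 1) * p x * (if x ∈ A then xRot (k + 1) else 1)⁻¹ =
            scal c hc * (g * p x) := by
      intro x
      split_ifs
      · exact xRot_conj_pauliOne k (hp x)
      · exact ⟨1, by simp, Or.inl rfl, 1, Or.inl rfl, by simp [scal_one]⟩
    choose c hc hc' g hg heq using hsite
    have h1 : onSet (xRot (k + 1)) A * tensor p * (onSet (xRot (k + 1)) A)⁻¹ =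
        tensor (fun x => scal (c x) (hc x)) * (tensor g * tensor p) := by
      unfold onSet
      rw [tensor_inv, tensor_mul, tensor_mul, tensor_mul, tensor_mul]
      congr 1
      funext x
      convert heq x
    -- The sites that acquire `X(k)` form a new set depending on the Pauli, so the induction
    -- hypothesis is needed for all sets.
    have hg' : tensor g = onSet (xRot k) {x | g x ≠ 1} := by
      unfold onSet
      congr 1
      funext x
      by_cases hx : g x = 1
      · simp [hx]
      · simpa [hx] using (hg x).resolve_left hx
    rw [h1]
    have hmem : tensor g * tensor p ∈ cliffordLevel ι k := by
      rw [hg']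
      exact cliffordLevel_mul_pauli (ih _) ⟨p, hp, rfl⟩
    -- At level `0` the phases must themselves be Pauli: they are `1` or `star (phase 1) = -i`.
    cases k with
    | zero =>
      refine pauliGroup_mul ⟨_, fun x => ?_, rfl⟩ hmem
      refine ⟨c x, ?_, 1, by simp, by simp [scal]⟩
      rcases hc' x with h | h <;> rw [h]
      · simp
      · simp [phase_one]
    | succ k => exact cliffordLevel_scal_mul (tensor_scal_comm c hc) hmem

end PauliClifford

/-! ### Passage to the Hadamard basis -/

section Hadamard

/-- The Hadamard gate. -/
def hadamard : U1 := ⟨(1 / (Real.sqrt 2 : ℂ)) • !![1, 1; 1, -1], by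
  have h : (Real.sqrt 2 : ℂ) * (Real.sqrt 2 : ℂ) = 2 := by
    rw [← Complex.ofReal_mul, Real.mul_self_sqrt (by norm_num)]; norm_num
  have h' : (Real.sqrt 2 : ℂ)⁻¹ * (Real.sqrt 2 : ℂ)⁻¹ = 1 / 2 := by
    rw [← mul_inv, h]; norm_num
  rw [mem_unitaryGroup_iff]
  ext i j
  fin_cases i <;> fin_cases j <;> simp [Matrix.mul_apply, Matrix.star_apply, h'] <;> norm_num⟩

/-- The diagonal gate `diag(1, c)`. -/
def diagGate (c : ℂ) (hc : c * star c = 1) : U1 := ⟨!![1, 0; 0, c], by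
  rw [mem_unitaryGroup_iff]
  rw [Complex.star_def] at hc
  ext i j
  fin_cases i <;> fin_cases j <;> simp [Matrix.mul_apply, Matrix.star_apply, hc]⟩

theorem xRot_mul_hadamard (k : ℕ) :
    xRot k * hadamard = hadamard * diagGate _ (phase_mul_star k) := by
  refine ext_U1 fun i j => ?_
  fin_cases i <;> fin_cases j <;>
    simp [xRot, xRotMatrix_eq, hadamard, diagGate] <;> ring

theorem pauliZ_mul_hadamard : pauliZ * hadamard = hadamard * pauliX := by
  refine ext_U1 fun i j => ?_
  fin_cases i <;> fin_cases j <;> simp [pauliX, pauliZ, hadamard]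

variable {ι : Type} [Fintype ι] [DecidableEq ι]

/-- The Hadamard gate on all qubits. -/
def hadamardAll (ι : Type) [Fintype ι] [DecidableEq ι] : UN ι := tensor fun _ => hadamard

theorem onSet_mul_hadamardAll {u v : U1} (h : u * hadamard = hadamard * v) (A : Set ι) :
    onSet u A * hadamardAll ι = hadamardAll ι * onSet v A := by
  classical
  unfold onSet hadamardAll
  rw [tensor_mul, tensor_mul]
  congr 1
  funext x
  split_ifs <;> simp [h]

/-- `ZMod 2` unfolds to `Fin 2`, so matrix entries can be indexed by bits that add modulo two. -/
theorem U1_one_apply (a b : ZMod 2) : (1 : U1).1 a b = if b = a then 1 else 0 := by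
  split_ifs with h
  · subst h
    exact Matrix.one_apply_eq _
  · exact Matrix.one_apply_ne fun h' => h h'.symm

theorem diagGate_apply (c : ℂ) (hc : c * star c = 1) (a b : ZMod 2) :
    (diagGate c hc).1 a b = if b = a then c ^ (if a = 1 then 1 else 0) else 0 := by
  have e00 : (diagGate c hc).1 (0 : ZMod 2) (0 : ZMod 2) = 1 := rfl
  have e01 : (diagGate c hc).1 (0 : ZMod 2) (1 : ZMod 2) = 0 := rfl
  have e10 : (diagGate c hc).1 (1 : ZMod 2) (0 : ZMod 2) = 0 := rfl
  have e11 : (diagGate c hc).1 (1 : ZMod 2) (1 : ZMod 2) = c := rfl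
  rcases zmod_two_cases a with rfl | rfl <;> rcases zmod_two_cases b with rfl | rfl
  · rw [e00]; simp
  · rw [e01]; simp
  · rw [e10]; simp
  · rw [e11]; simp

theorem pauliX_apply (a b : ZMod 2) : pauliX.1 a b = if b = a + 1 then 1 else 0 := by
  have e00 : pauliX.1 (0 : ZMod 2) (0 : ZMod 2) = 0 := rfl
  have e01 : pauliX.1 (0 : ZMod 2) (1 : ZMod 2) = 1 := rfl
  have e10 : pauliX.1 (1 : ZMod 2) (0 : ZMod 2) = 1 := rfl
  have e11 : pauliX.1 (1 : ZMod 2) (1 : ZMod 2) = 0 := rfl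
  have h2 : (1 : ZMod 2) + 1 = 0 := by decide
  rcases zmod_two_cases a with rfl | rfl <;> rcases zmod_two_cases b with rfl | rfl
  · rw [e00]; simp
  · rw [e01]; simp
  · rw [e10]; simp [h2]
  · rw [e11]; simp [h2]

theorem onSet_diagGate_mulVec (c : ℂ) (hc : c * star c = 1) (A : Set ι) (φ : State ι)
    (t : ι → ZMod 2) : ((onSet (diagGate c hc) A : UN ι).1 *ᵥ φ) t = c ^ wt A t * φ t := by
  classical
  have h : ∀ s u : ι → ZMod 2, (onSet (diagGate c hc) A : UN ι).1 s u =
      if u = s then c ^ wt A s else 0 := by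
    intro s u
    have hx : ∀ x, ((if x ∈ A then diagGate c hc else 1 : U1) : Matrix (Fin 2) (Fin 2) ℂ)
        (s x) (u x) = if u x = s x then (c ^ if x ∈ A ∧ s x = 1 then 1 else 0) else 0 := by
      intro x
      by_cases hA : x ∈ A
      · simp only [hA, if_true, true_and]
        exact diagGate_apply c hc (s x) (u x)
      · simp only [hA, if_false, false_and, pow_zero]
        exact U1_one_apply (s x) (u x)
    change ∏ x, ((if x ∈ A then diagGate c hc else 1 : U1) : Matrix (Fin 2) (Fin 2) ℂ)
      (s x) (u x) = _
    rw [Finset.prod_congr rfl fun x _ => hx x, Finset.prod_ite_zero, Finset.prod_pow_eq_pow_sum]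
    by_cases hus : u = s
    · rw [if_pos hus, if_pos fun x _ => congrFun hus x]
      rfl
    · rw [if_neg hus, if_neg fun h => hus (funext fun x => h x (Finset.mem_univ x))]
  calc _ = ∑ u : ι → ZMod 2, (onSet (diagGate c hc) A : UN ι).1 t u * φ u := rfl
    _ = _ := by
      simp_rw [h, ite_mul, zero_mul]
      exact (Finset.sum_ite_eq' Finset.univ t (fun u : ι → ZMod 2 => c ^ wt A t * φ u)).trans
        (if_pos (Finset.mem_univ _))

theorem onSet_pauliX_mulVec (A : Set ι) (φ : State ι) (t : ι → ZMod 2) :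
    ((onSet pauliX A : UN ι).1 *ᵥ φ) t = φ (t + ind A : ι → ZMod 2) := by
  classical
  have h : ∀ s u : ι → ZMod 2, (onSet pauliX A : UN ι).1 s u =
      if u = s + ind A then 1 else 0 := by
    intro s u
    have hx : ∀ x, ((if x ∈ A then pauliX else 1 : U1) : Matrix (Fin 2) (Fin 2) ℂ)
        (s x) (u x) = if u x = (s + ind A) x then 1 else 0 := by
      intro x
      rw [Pi.add_apply]
      by_cases hA : x ∈ A
      · simp only [hA, if_true, ind]
        exact pauliX_apply (s x) (u x)
      · simp only [hA, if_false, ind, add_zero]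
        exact U1_one_apply (s x) (u x)
    change ∏ x, ((if x ∈ A then pauliX else 1 : U1) : Matrix (Fin 2) (Fin 2) ℂ)
      (s x) (u x) = _
    rw [Finset.prod_congr rfl fun x _ => hx x, Finset.prod_ite_zero, Finset.prod_const_one]
    by_cases hus : u = s + ind A
    · rw [if_pos hus, if_pos fun x _ => congrFun hus x]
    · rw [if_neg hus, if_neg fun h => hus (funext fun x => h x (Finset.mem_univ x))]
  calc _ = ∑ u : ι → ZMod 2, (onSet pauliX A : UN ι).1 t u * φ u := rfl
    _ = _ := by
      simp_rw [h, ite_mul, one_mul, zero_mul]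
      exact (Finset.sum_ite_eq' Finset.univ (t + ind A) (fun u : ι → ZMod 2 => φ u)).trans
        (if_pos (Finset.mem_univ _))

end Hadamard

end

end QRM

namespace QRM

open Matrix

/-! ### Stabilizer codes and the action of `X(k)_A` -/

section Codes

variable {ι : Type} [Fintype ι] [DecidableEq ι]

theorem state_eq_iff {κ : Type} {φ χ : State κ} : φ = χ ↔ ∀ t : κ → ZMod 2, φ t = χ t := funext_iff

theorem mulVec_mul_eq (U V : UN ι) (ψ : State ι) : (U * V).1 *ᵥ ψ = U.1 *ᵥ (V.1 *ᵥ ψ) := by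
  rw [mulVec_mulVec, Matrix.UnitaryGroup.mul_val]

theorem inv_mulVec_mulVec (U : UN ι) (ψ : State ι) : (U⁻¹).1 *ᵥ (U.1 *ᵥ ψ) = ψ := by
  rw [← mulVec_mul_eq, inv_mul_cancel, Matrix.UnitaryGroup.one_val, one_mulVec]

theorem mulVec_inv_mulVec (U : UN ι) (ψ : State ι) : U.1 *ᵥ ((U⁻¹).1 *ᵥ ψ) = ψ := by
  rw [← mulVec_mul_eq, mul_inv_cancel, Matrix.UnitaryGroup.one_val, one_mulVec]

theorem unitary_mulVec_injective (U : UN ι) : Function.Injective fun ψ : State ι => U.1 *ᵥ ψ :=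
  Function.LeftInverse.injective (inv_mulVec_mulVec U)

theorem mem_stabilizerCode_closure {G : Set (UN ι)} {ψ : State ι} :
    ψ ∈ stabilizerCode (Subgroup.closure G) ↔ ∀ U ∈ G, U.1 *ᵥ ψ = ψ := by
  refine ⟨fun h U hU => h U (Subgroup.subset_closure hU), fun h U hU => ?_⟩
  induction hU using Subgroup.closure_induction with
  | mem U hU => exact h U hU
  | one => rw [Matrix.UnitaryGroup.one_val, one_mulVec]
  | mul U V _ _ hU hV => rw [mulVec_mul_eq, hV, hU]
  | inv U _ hU =>
    conv_lhs => rw [← hU]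
    exact inv_mulVec_mulVec U ψ

/-- A unitary is injective, so by finite dimension mapping the code into itself means mapping it
onto itself. -/
theorem mem_undetectableErrors_iff {C : Submodule ℂ (State ι)} {U : UN ι} :
    U ∈ undetectableErrors C ↔ ∀ ψ ∈ C, U.1 *ᵥ ψ ∈ C := by
  constructor
  · intro h ψ hψ
    have h' : C.map U.1.mulVecLin = C := h
    rw [← h']
    exact Submodule.mem_map_of_mem (f := U.1.mulVecLin) hψ
  · intro h
    refine Submodule.eq_of_le_of_finrank_eq ?_ ?_
    · rintro _ ⟨ψ, hψ, rfl⟩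
      exact h ψ hψ
    · exact (Submodule.equivMapOfInjective U.1.mulVecLin (unitary_mulVec_injective U) C).finrank_eq.symm

theorem mem_undetectableErrors_inv {C : Submodule ℂ (State ι)} {U : UN ι} :
    U⁻¹ ∈ undetectableErrors C ↔ U ∈ undetectableErrors C := by
  have key : ∀ V : UN ι, V ∈ undetectableErrors C → V⁻¹ ∈ undetectableErrors C := by
    intro V hV
    rw [mem_undetectableErrors_iff]
    intro ψ hψ
    have h' : C.map V.1.mulVecLin = C := hV
    rw [← h'] at hψ
    obtain ⟨χ, hχ, rfl⟩ := hψ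
    rw [mulVecLin_apply, inv_mulVec_mulVec]
    exact hχ
  exact ⟨fun h => inv_inv U ▸ key _ h, key U⟩

/-- For a code that is stabilized by Pauli operators, the level-`k` Clifford errors are the
undetectable unitary errors in the `k`-th level of the Clifford hierarchy. -/
theorem mem_cliffordErrors_iff {G : Set (UN ι)} (hG : G ⊆ pauliGroup ι) {k : ℕ} {U : UN ι} :
    U ∈ cliffordErrors (stabilizerCode (Subgroup.closure G)) k ↔
      U ∈ cliffordLevel ι k ∧ U ∈ undetectableErrors (stabilizerCode (Subgroup.closure G)) := by
  set C := stabilizerCode (Subgroup.closure G) with hC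
  refine and_congr_right fun hU => ?_
  -- `U S U⁻¹` fixes the code exactly when `S` fixes its image under `U⁻¹`.
  rw [← mem_undetectableErrors_inv, mem_undetectableErrors_iff]
  constructor
  · intro h ψ hψ
    rw [hC, mem_stabilizerCode_closure]
    intro S hS
    have := (h S ⟨hG hS, fun χ hχ => mem_stabilizerCode_closure.mp hχ S hS⟩).2 ψ hψ
    rw [mulVec_mul_eq, mulVec_mul_eq] at this
    apply unitary_mulVec_injective U
    simp only
    rw [this, mulVec_inv_mulVec]
  · intro h S hS
    refine ⟨?_, fun ψ hψ => ?_⟩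
    · cases k with
      | zero => exact pauliGroup_mul (pauliGroup_mul hU hS.1) (pauliGroup_inv hU)
      | succ k => exact hU S hS.1
    · rw [mulVec_mul_eq, mulVec_mul_eq, hS.2 _ (h ψ hψ), mulVec_inv_mulVec]

theorem mem_cliffordStabilizers_iff {C : Submodule ℂ (State ι)} {k : ℕ} {U : UN ι} :
    U ∈ cliffordStabilizers C k ↔ U ∈ cliffordLevel ι k ∧ U ∈ unitaryStabilizers C := Iff.rfl

theorem mem_cliffordLogicals_iff {G : Set (UN ι)} (hG : G ⊆ pauliGroup ι) {k : ℕ} {U : UN ι} :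
    U ∈ cliffordLogicals (stabilizerCode (Subgroup.closure G)) k ↔
      U ∈ cliffordLevel ι k ∧ U ∈ logicalOperators (stabilizerCode (Subgroup.closure G)) := by
  unfold cliffordLogicals logicalOperators
  rw [Set.mem_sdiff, Set.mem_sdiff, mem_cliffordErrors_iff hG, mem_cliffordStabilizers_iff]
  tauto

theorem generators_subset_pauliGroup (m q r : ℕ) :
    xGenerators m q ∪ zGenerators m r ⊆ pauliGroup (Cube m) := by
  rintro _ (⟨A, -, rfl⟩ | ⟨A, -, rfl⟩)
  · exact onSet_mem_pauliGroup (pauli_mem (by simp)) A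
  · exact onSet_mem_pauliGroup (pauli_mem (by simp)) A

theorem isPrimitiveRoot_phase (k : ℕ) : IsPrimitiveRoot (phase k) (2 ^ (k + 1)) := by
  have h := Complex.isPrimitiveRoot_exp (2 ^ (k + 1)) (by positivity)
  have : phase k = Complex.exp (2 * Real.pi * Complex.I / ((2 ^ (k + 1) : ℕ) : ℂ)) := by
    unfold phase
    congr 1
    push_cast
    rw [pow_succ]
    field_simp
  rwa [this]

theorem phase_pow_eq_iff (k a b : ℕ) : phase k ^ a = phase k ^ b ↔ a ≡ b [MOD 2 ^ (k + 1)] := by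
  have h := isPrimitiveRoot_phase k
  have h0 : phase k ≠ 0 := h.ne_zero (by positivity)
  have hu : IsPrimitiveRoot (Units.mk0 (phase k) h0) (2 ^ (k + 1)) :=
    IsPrimitiveRoot.coe_units_iff.mp h
  rw [hu.eq_orderOf, ← pow_eq_pow_iff_modEq, Units.ext_iff]
  simp

theorem phase_pow_eq_one_iff (k a : ℕ) : phase k ^ a = 1 ↔ 2 ^ (k + 1) ∣ a :=
  (isPrimitiveRoot_phase k).pow_eq_one_iff_dvd a

variable {m q r k : ℕ}

/-- The code in the Hadamard basis: states supported on the strings that meet the `(m-q)`-cubes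
evenly and invariant under translation by the `(r+1)`-cubes. -/
def InDualCode (m q r : ℕ) (φ : (Cube m → ZMod 2) → ℂ) : Prop :=
  (∀ t, φ t ≠ 0 → t ∈ evenOn m (m - q)) ∧ ∀ B, IsSubcube B (r + 1) → ∀ t, φ (t + ind B) = φ t

theorem intertwined_mulVec {U H V : UN ι} (h : U * H = H * V) (φ : State ι) :
    U.1 *ᵥ (H.1 *ᵥ φ) = H.1 *ᵥ (V.1 *ᵥ φ) := by
  rw [← mulVec_mul_eq, h, mulVec_mul_eq]

/-- After Hadamards, `X_B` is the sign `(-1) ^ wt B t` and `Z_B` is translation by `ind B`. -/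
theorem hadamardAll_mulVec_mem_code_iff {φ : State (Cube m)} :
    (hadamardAll (Cube m)).1 *ᵥ φ ∈ code m q r ↔ InDualCode m q r φ := by
  have hX : ∀ B : Set (Cube m), (onSet pauliX B).1 *ᵥ ((hadamardAll (Cube m)).1 *ᵥ φ) =
      (hadamardAll (Cube m)).1 *ᵥ φ ↔ ∀ t : Cube m → ZMod 2, φ t ≠ 0 → Even (wt B t) := by
    intro B
    rw [← xRot_zero, intertwined_mulVec (onSet_mul_hadamardAll (xRot_mul_hadamard 0) B),
      (unitary_mulVec_injective (hadamardAll (Cube m))).eq_iff, state_eq_iff]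
    refine forall_congr' fun t => ?_
    rw [onSet_diagGate_mulVec]
    by_cases h0 : φ t = 0
    · simp [h0]
    · rw [mul_eq_right₀ h0, phase_pow_eq_one_iff, even_iff_two_dvd]
      simp [h0]
  have hZ : ∀ B : Set (Cube m), (onSet pauliZ B).1 *ᵥ ((hadamardAll (Cube m)).1 *ᵥ φ) =
      (hadamardAll (Cube m)).1 *ᵥ φ ↔ ∀ t : Cube m → ZMod 2,
        φ (t + ind B : Cube m → ZMod 2) = φ t := by
    intro B
    rw [intertwined_mulVec (onSet_mul_hadamardAll pauliZ_mul_hadamard B),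
      (unitary_mulVec_injective (hadamardAll (Cube m))).eq_iff, state_eq_iff]
    refine forall_congr' fun t => ?_
    rw [onSet_pauliX_mulVec]
  unfold code InDualCode evenOn
  rw [mem_stabilizerCode_closure]
  constructor
  · intro h
    exact ⟨fun t ht B hB => (hX B).mp (h _ (Or.inl ⟨B, hB, rfl⟩)) t ht,
      fun B hB => (hZ B).mp (h _ (Or.inr ⟨B, hB, rfl⟩))⟩
  · rintro ⟨h1, h2⟩ _ (⟨B, hB, rfl⟩ | ⟨B, hB, rfl⟩)
    · exact (hX B).mpr fun t ht => h1 t ht B hB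
    · exact (hZ B).mpr (h2 B hB)

theorem forall_mem_code_iff {P : State (Cube m) → Prop} :
    (∀ ψ ∈ code m q r, P ψ) ↔
      ∀ φ : State (Cube m), InDualCode m q r φ → P ((hadamardAll (Cube m)).1 *ᵥ φ) := by
  constructor
  · intro h φ hφ
    exact h _ (hadamardAll_mulVec_mem_code_iff.mpr hφ)
  · intro h ψ hψ
    have := h ((hadamardAll (Cube m))⁻¹.1 *ᵥ ψ)
      (hadamardAll_mulVec_mem_code_iff.mp (by rwa [mulVec_inv_mulVec]))
    rwa [mulVec_inv_mulVec] at this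

open Classical in
/-- Every string that meets the `(m-q)`-cubes evenly supports a code state. -/
theorem exists_inDualCode (hqr : q ≤ r) (hrm : r ≤ m) {t : Cube m → ZMod 2}
    (ht : t ∈ evenOn m (m - q)) : ∃ φ, InDualCode m q r φ ∧ φ t = 1 := by
  have htwo : ∀ u : Cube m → ZMod 2, u + u = 0 := fun u => by
    ext x
    have : ∀ a : ZMod 2, a + a = 0 := by decide
    exact this _
  -- The indicator of the coset of `t` modulo the translations; `q ≤ r` keeps this coset inside the
  -- allowed support.
  refine ⟨fun u => if u + t ∈ cubeSpan m (r + 1) then 1 else 0, ⟨fun u hu => ?_, fun B hB u => ?_⟩,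
    ?_⟩
  · have hu' : u + t ∈ cubeSpan m (r + 1) := by
      by_contra h
      simp [h] at hu
    have := add_mem_evenOn (cubeSpan_subset_evenOn (by omega) hu') ht
    rwa [add_assoc, htwo, add_zero] at this
  · refine if_congr ?_ rfl rfl
    constructor
    · intro h
      have := add_mem h (ind_mem_cubeSpan hB)
      rwa [show u + ind B + t + ind B = u + t + (ind B + ind B) by abel, htwo, add_zero] at this
    · intro h
      rw [add_right_comm]
      exact add_mem h (ind_mem_cubeSpan hB)
  · simp [htwo]

theorem xRot_mem_unitaryStabilizers_iff (hqr : q ≤ r) (hrm : r ≤ m) {A : Set (Cube m)} :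
    onSet (xRot k) A ∈ unitaryStabilizers (code m q r) ↔
      ∀ t ∈ evenOn m (m - q), 2 ^ (k + 1) ∣ wt A t := by
  have hact : ∀ φ : State (Cube m), (onSet (xRot k) A).1 *ᵥ ((hadamardAll (Cube m)).1 *ᵥ φ) =
      (hadamardAll (Cube m)).1 *ᵥ φ ↔
        ∀ t : Cube m → ZMod 2, φ t ≠ 0 → 2 ^ (k + 1) ∣ wt A t := by
    intro φ
    rw [intertwined_mulVec (onSet_mul_hadamardAll (xRot_mul_hadamard k) A),
      (unitary_mulVec_injective (hadamardAll (Cube m))).eq_iff, state_eq_iff]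
    refine forall_congr' fun t => ?_
    rw [onSet_diagGate_mulVec]
    by_cases h0 : φ t = 0
    · simp [h0]
    · rw [mul_eq_right₀ h0, phase_pow_eq_one_iff]
      simp [h0]
  change (∀ ψ ∈ code m q r, _) ↔ _
  rw [forall_mem_code_iff]
  simp only [hact]
  constructor
  · intro h t ht
    obtain ⟨φ, hφ, h1⟩ := exists_inDualCode hqr hrm ht
    exact h φ hφ t (by rw [h1]; exact one_ne_zero)
  · intro h φ hφ t ht
    exact h t (hφ.1 t ht)

/-- A diagonal operator cannot enlarge the support, so only translation invariance can fail. -/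
theorem xRot_mem_undetectableErrors_iff (hqr : q ≤ r) (hrm : r ≤ m) {A : Set (Cube m)} :
    onSet (xRot k) A ∈ undetectableErrors (code m q r) ↔
      ∀ t ∈ evenOn m (m - q), ∀ B, IsSubcube B (r + 1) →
        wt A (t + ind B) ≡ wt A t [MOD 2 ^ (k + 1)] := by
  rw [mem_undetectableErrors_iff, forall_mem_code_iff]
  simp only [intertwined_mulVec (onSet_mul_hadamardAll (xRot_mul_hadamard k) A),
    hadamardAll_mulVec_mem_code_iff, InDualCode, onSet_diagGate_mulVec]
  constructor
  · intro h t ht B hB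
    obtain ⟨φ, hφ, h1⟩ := exists_inDualCode hqr hrm ht
    have := (h φ hφ).2 B hB t
    rw [hφ.2 B hB t, h1, mul_one, mul_one] at this
    exact (phase_pow_eq_iff k _ _).mp this
  · rintro h φ ⟨h1, h2⟩
    refine ⟨fun t ht => h1 t (right_ne_zero_of_mul ht), fun B hB t => ?_⟩
    rw [h2 B hB t]
    by_cases h0 : φ t = 0
    · rw [h0, mul_zero, mul_zero]
    · rw [(phase_pow_eq_iff k _ _).mpr (h t (h1 t h0) B hB)]

theorem evenOn_zero_left (t : Cube m → ZMod 2) (ht : t ∈ evenOn m 0) : t = 0 := by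
  have h := evenOn_subset_cubeSpan (n := m + 1) (by omega) ht
  have hall : ∀ u ∈ cubeSpan m (m + 1), u = 0 := by
    intro u hu
    induction hu using AddSubmonoid.closure_induction with
    | mem u hu =>
      obtain ⟨B, hB, -⟩ := hu
      have := hB.le
      omega
    | zero => rfl
    | add u v _ _ hu hv => rw [hu, hv, add_zero]
  exact hall t h

/-- If `q = r`, then the undetectable errors among the `X(k)_A` fix the code. -/
theorem undetectable_imp_stabilizer (hqm : q ≤ m) {A : Set (Cube m)}
    (h : onSet (xRot k) A ∈ undetectableErrors (code m q q)) :
    onSet (xRot k) A ∈ unitaryStabilizers (code m q q) := by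
  rw [xRot_mem_undetectableErrors_iff le_rfl hqm] at h
  rw [xRot_mem_unitaryStabilizers_iff le_rfl hqm]
  intro t ht
  -- For `q = r` the allowed strings are generated by the translations themselves, so each is
  -- reached from `0`, which has weight zero.
  have ht' := evenOn_subset_cubeSpan (n := q + 1) (by omega) ht
  clear ht
  induction ht' using AddSubmonoid.closure_induction_right with
  | zero => simp [wt_zero]
  | add_right t ht u hu ih =>
    obtain ⟨B, hB, rfl⟩ := hu
    have := h t (cubeSpan_subset_evenOn (by omega) ht) B hB
    exact Nat.modEq_zero_iff_dvd.mp (this.trans (Nat.modEq_zero_iff_dvd.mpr ih))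

theorem xRot_stabilizer_iff (hqr : q ≤ r) (hrm : r ≤ m) (hk : k = 0 ∨ q + 1 ≠ m)
    {A : Set (Cube m)} {d : ℕ} (hA : IsSubcube A d) :
    onSet (xRot k) A ∈ unitaryStabilizers (code m q r) ↔
      ((k : ℤ) + 1) * ((m : ℤ) - q - 1) + 1 ≤ (d : ℤ) := by
  rw [xRot_mem_unitaryStabilizers_iff hqr hrm]
  rcases (hqr.trans hrm).eq_or_lt with rfl | hqm
  · refine iff_of_true (fun t ht => ?_) ?_
    · rw [Nat.sub_self] at ht
      rw [evenOn_zero_left t ht, wt_zero]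
      exact dvd_zero _
    · have : ((k : ℤ) + 1) * ((q : ℤ) - q - 1) + 1 = -k := by ring
      omega
  · obtain ⟨s, rfl⟩ : ∃ s, m = q + s + 1 := ⟨m - q - 1, by omega⟩
    have h1 : q + s + 1 - q = s + 1 := by omega
    have h2 : ((q + s + 1 : ℕ) : ℤ) - q - 1 = s := by push_cast; ring
    rw [h1, h2, forall_pow_dvd_wt_iff (by omega) (hk.symm.imp_left fun h => by omega) hA]
    norm_cast

theorem xRot_logical_iff (hqr : q ≤ r) (hrm : r ≤ m) (hk : k = 0 ∨ ¬ (q < r ∧ r = m))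
    {A : Set (Cube m)} {d : ℕ} (hA : IsSubcube A d) :
    onSet (xRot k) A ∈ logicalOperators (code m q r) ↔
      (m : ℤ) - r + k * ((m : ℤ) - q - 1) ≤ (d : ℤ) ∧
        (d : ℤ) ≤ ((k : ℤ) + 1) * ((m : ℤ) - q - 1) := by
  rcases hqr.eq_or_lt with rfl | hqr'
  · refine iff_of_false (fun h => h.2 (undetectable_imp_stabilizer hrm h.1)) ?_
    rintro ⟨h1, h2⟩
    linarith
  · have hS := xRot_stabilizer_iff (k := k) hqr hrm (by omega) hA
    have hN : onSet (xRot k) A ∈ undetectableErrors (code m q r) ↔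
        (m : ℤ) - r + k * ((m : ℤ) - q - 1) ≤ (d : ℤ) := by
      rw [xRot_mem_undetectableErrors_iff hqr hrm]
      -- For `r = m` there are no `(r+1)`-cubes, so every `X(k)_A` is undetectable; the bound agrees
      -- because here `k = 0`.
      rcases hrm.eq_or_lt with rfl | hrm'
      · have hk0 : k = 0 := by omega
        subst hk0
        refine iff_of_true (fun t _ B hB => ?_) (by simp)
        have := hB.le
        omega
      · obtain ⟨p, rfl⟩ : ∃ p, m = r + p + 1 := ⟨m - r - 1, by omega⟩
        obtain ⟨e, rfl⟩ : ∃ e, r = q + e := ⟨r - q, by omega⟩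
        have h1 : q + e + p + 1 - q = (e + p) + 1 := by omega
        have h2 : q + e + p + 1 - p = q + e + 1 := by omega
        have h3 : (((q + e + p + 1 : ℕ) : ℤ) - ((q + e : ℕ) : ℤ) +
            k * (((q + e + p + 1 : ℕ) : ℤ) - q - 1) ≤ (d : ℤ)) ↔
              k * (e + p) + p + 1 ≤ d := by
          have : (((q + e + p + 1 : ℕ) : ℤ) - ((q + e : ℕ) : ℤ) +
            k * (((q + e + p + 1 : ℕ) : ℤ) - q - 1)) = ((k * (e + p) + p + 1 : ℕ) : ℤ) := by
            push_cast
            ring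
          rw [this, Nat.cast_le]
        rw [h1, h3]
        constructor
        · intro h
          exact le_of_forall_modEq (s := e + p) (by omega) (by omega) hA fun t ht B hB =>
            h t ht B (h2 ▸ hB)
        · intro h t ht B hB
          exact pow_dvd_wt_add_ind_modEq (n := q + 1) (s := e + p) (by omega)
            (evenOn_subset_cubeSpan (by omega) ht) (Or.inl (by omega)) hA hB (by omega)
    unfold logicalOperators
    rw [Set.mem_sdiff, hN, hS, not_le, Int.lt_add_one_iff]

end Codes

end QRM

theorem mainTheorem8 (m q r k : ℕ) (hqr : q ≤ r) (hrm : r ≤ m)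
    (A : Set (QRM.Cube m)) (d : ℕ) (hA : QRM.IsSubcube A d) :
    ((k = 0 ∨ q + 1 ≠ m) →
      (QRM.onSet (QRM.xRot k) A ∈ QRM.unitaryStabilizers (QRM.code m q r) ↔
        ((k : ℤ) + 1) * ((m : ℤ) - q - 1) + 1 ≤ (d : ℤ)) ∧
      (QRM.onSet (QRM.xRot k) A ∈ QRM.cliffordStabilizers (QRM.code m q r) k ↔
        ((k : ℤ) + 1) * ((m : ℤ) - q - 1) + 1 ≤ (d : ℤ))) ∧
    ((k = 0 ∨ ¬ (q < r ∧ r = m)) →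
      (QRM.onSet (QRM.xRot k) A ∈ QRM.logicalOperators (QRM.code m q r) ↔
        (m : ℤ) - r + k * ((m : ℤ) - q - 1) ≤ (d : ℤ) ∧
          (d : ℤ) ≤ ((k : ℤ) + 1) * ((m : ℤ) - q - 1)) ∧
      (QRM.onSet (QRM.xRot k) A ∈ QRM.cliffordLogicals (QRM.code m q r) k ↔
        (m : ℤ) - r + k * ((m : ℤ) - q - 1) ≤ (d : ℤ) ∧
          (d : ℤ) ≤ ((k : ℤ) + 1) * ((m : ℤ) - q - 1))) := by
  have hlevel := QRM.onSet_xRot_mem_cliffordLevel k A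
  refine ⟨fun hk => ?_, fun hk => ?_⟩
  · have h := QRM.xRot_stabilizer_iff hqr hrm hk hA
    exact ⟨h, QRM.mem_cliffordStabilizers_iff.trans ((and_iff_right hlevel).trans h)⟩
  · have h := QRM.xRot_logical_iff hqr hrm hk hA
    exact ⟨h, (QRM.mem_cliffordLogicals_iff (QRM.generators_subset_pauliGroup m q r)).trans
      ((and_iff_right hlevel).trans h)⟩
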